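/- **Conventions.** Manifolds and actions are $C^\infty$, submanifolds are embedded. An $n$-dimensional orbifold chart on a second countable Hausdorff space $X$ is $(U,\widetilde U/\Gamma,\pi)$ with $U\subset X$ open, $\widetilde U$ a connected (second countable, Hausdorff) $n$-manifold, $\Gamma$ a finite group acting smoothly and effectively on $\widetilde U$, and $\pi\colon\widetilde U\to U$ a continuous $\Gamma$-invariant map inducing a homeomorphism $\widetilde U/\Gamma\to U$. An injection between charts is a smooth embedding $\lambda\colon\widetilde U_1\to\widetilde U_2$ with $\pi_2\circ\lambda=\pi_1$. Two charts are compatible if every $x\in U_1\cap U_2$ lies in a chart $(W,\widetilde W/K,\sigma)$ with $W\subset U_1\cap U_2$ which admits injections into both. An atlas is a covering family of pairwise compatible charts; an orbifold $(X,\mathcal A)$ is such an $X$ with a maximal atlas. The product orbifold $(X\times X',\mathcal A\times\mathcal A')$ carries the maximal atlas containing all products of charts. A point $x\in X$ is regular if its isotropy $\Gamma_{\tilde x}$ ($\tilde x\in\pi^{-1}(x)$, in any chart around $x$) is trivial, and singular otherwise. The stratum of a singular point $x$ is formed by the points whose isotropy group is isomorphic to that of $x$ (or by their connected components); in a chart it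 is given near $\tilde x$ by the submanifold $\{q:\Gamma_q\cong\Gamma_{\tilde x}\}$, and the singular strata have codimension at least two if the dimension of this submanifold at $\tilde x$ is at most $n-2$ for every singular $x$. A smooth map $f\colon(X,\mathcal A)\to(X',\mathcal A')$ is a continuous map $X\to X'$ such that for every $x$ there are charts $(U,\widetilde U/\Gamma,\pi)\in\mathcal A$ around $x$ and $(U',\widetilde U'/\Gamma',\pi')\in\mathcal A'$ around $f(x)$, a smooth map $\widetilde f\colon\widetilde U\to\widetilde U'$ and a homomorphism $\overline f\colon\Gamma\to\Gamma'$ with $\pi'\circ\widetilde f=f\circ\pi$ and $\widetilde f(\gamma p)=\overline f(\gamma)\widetilde f(p)$. A closed ($k$-dimensional) suborbifold cover of $Y\subset X$ with respect to an atlas $\{(U_i,\widetilde U_i/\Gamma_i,\pi_i)\}_{i\in I}$ is a subset $J\subset I$ with closed connected $k$-dimensional submanifolds $\widetilde V_j\subset\widetilde U_j$ $(j\in J)$ such that each $\widetilde V_j$ is a $\Delta_j$-submanifold for some subgroup $\Delta_j\le\Gamma_j$ (it is $\Delta_j$-invariant, and if $p,\gamma p\in\widetilde V_j$ with $\gamma\in\Gamma_j$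 then $\delta p=\gamma p$ for some $\delta\in\Delta_j$), each $\pi_j(\widetilde V_j)$ is open in $Y$, and $\bigcup_j\pi_j(\widetilde V_j)=Y$. The cover is *regular* if each $\{p\in\widetilde V_j:(\Gamma_j)_p=\{e\}\}$ is connected and dense in $\widetilde V_j$. It is *very strong* if (1) $\gamma\in\Gamma_j$ fixing a nonempty open subset of $\widetilde V_j$ pointwise implies $\gamma=e$; and (2) for all $j_1,j_2\in J$ and $x\in\pi_{j_1}(\widetilde V_{j_1})\cap\pi_{j_2}(\widetilde V_{j_2})$ there are an orbifold chart $(W,\widetilde W/K,\sigma)$ on $X$, a subgroup $\Lambda\le K$, a $k$-dimensional $\Lambda$-submanifold $\widetilde Z\subset\widetilde W$ with $\sigma(\widetilde Z)$ an open neighbourhood of $x$ in $Y$, and injections $\lambda_m\colon\widetilde W\to\widetilde U_{j_m}$ with $\lambda_m(\widetilde Z)\subset\widetilde V_{j_m}$, $m=1,2$. A subset $Y$ of an orbifold $(X,\mathcal A)$ is a *regular* (resp. *very strong*) suborbifold if it has a regular (resp. very strong) suborbifold cover with respect to some countable atlas contained in $\mathcal A$. **Proposition.** Let $(X,\mathcal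 A)$ be an orbifold whose singular strata have codimension at least two. (a) If $(X',\mathcal A')$ is an orbifold and $f\colon(X,\mathcal A)\to(X',\mathcal A')$ is a smooth map that sends regular points to regular points, then the graph $\{(x,f(x)):x\in X\}$ is a regular suborbifold of $(X\times X',\mathcal A\times\mathcal A')$. (b) The diagonal $\{(x,x):x\in X\}$ is a very strong suborbifold of $(X\times X,\mathcal A\times\mathcal A)$. -/

import Mathlib

open scoped Manifold ContDiff Topology

universe w

noncomputable section

/-! ### Submanifolds -/

section Submanifold

variable {E : Type*} [NormedAddCommGroup E] [NormedSpace ℝ E]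
  {M : Type*} [TopologicalSpace M] [ChartedSpace E M]

variable (E) in
/-- `S` is, near `p`, an embedded smooth submanifold of dimension `k` of the smooth manifold `M`:
there is a smooth slice chart at `p`, that is, a chart of the smooth structure of `M` around `p` in
which `S` corresponds to a `k`-dimensional linear subspace of the model space. -/
def IsSubmanifoldAt (k : ℕ) (S : Set M) (p : M) : Prop :=
  ∃ φ ∈ IsManifold.maximalAtlas 𝓘(ℝ, E) ∞ M, p ∈ φ.source ∧
    ∃ F : Submodule ℝ E, Module.finrank ℝ F = k ∧ ∀ q ∈ φ.source, q ∈ S ↔ φ q ∈ F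

variable (E) in
/-- `S ⊆ M` is a `k`-dimensional embedded smooth submanifold. -/
def IsSubmanifold (k : ℕ) (S : Set M) : Prop :=
  ∀ p ∈ S, IsSubmanifoldAt E k S p

variable (E) in
/-- Given an action of `Γ` on `M` and a subgroup `Δ ≤ Γ`, the set `N` is a `k`-dimensional
`Δ`-submanifold of `M`: it is a `Δ`-invariant embedded submanifold, and whenever `p` and `γ • p` both
lie in `N`, there is some `δ ∈ Δ` such that `δ • p = γ • p`. -/
structure IsGroupSubmanifold {Γ : Type*} [Group Γ] [MulAction Γ M] (k : ℕ) (Δ : Subgroup Γ)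
    (N : Set M) : Prop where
  isSubmanifold : IsSubmanifold E k N
  invariant : ∀ δ ∈ Δ, ∀ p ∈ N, δ • p ∈ N
  exists_smul_eq : ∀ γ : Γ, ∀ p ∈ N, γ • p ∈ N → ∃ δ ∈ Δ, δ • p = γ • p

end Submanifold

/-! ### Orbifold charts -/

/-- An orbifold chart `(U, Ũ/Γ, π)` on `X`, of dimension `dim E`. Here `carrier` is the connected
(second countable, Hausdorff) manifold `Ũ`, modelled on the finite-dimensional space `E`, `group` is
the finite group `Γ`, acting smoothly and effectively, and `proj` is the map `π : Ũ → X`. The map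
induced by `π` on the orbit space `Ũ/Γ` is a homeomorphism onto an open set `U` (the range
of `π`). -/
structure OrbifoldChart (E : Type*) [NormedAddCommGroup E] [NormedSpace ℝ E]
    (X : Type*) [TopologicalSpace X] where
  carrier : Type w
  [topology : TopologicalSpace carrier]
  [chartedSpace : ChartedSpace E carrier]
  [isManifold : IsManifold 𝓘(ℝ, E) ∞ carrier]
  [t2 : T2Space carrier]
  [secondCountable : SecondCountableTopology carrier]
  [connected : ConnectedSpace carrier]
  group : Type w
  [groupStr : Group group]
  [finite : Finite group]
  [action : MulAction group carrier]
  [effective : FaithfulSMul group carrier]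
  smooth_smul : ∀ γ : group, ContMDiff 𝓘(ℝ, E) 𝓘(ℝ, E) ∞ (fun p : carrier => γ • p)
  proj : carrier → X
  proj_smul : ∀ (γ : group) (p : carrier), proj (γ • p) = proj p
  isOpenEmbedding_quotient : Topology.IsOpenEmbedding
    (Quotient.lift proj
      (fun _ b (h : MulAction.orbitRel group carrier _ b) => by
        obtain ⟨γ, rfl⟩ := h
        exact proj_smul γ b) :
      MulAction.orbitRel.Quotient group carrier → X)

namespace OrbifoldChart

attribute [instance] topology chartedSpace isManifold t2 secondCountable connected groupStr finite
  action effective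

section Basic

variable {E : Type*} [NormedAddCommGroup E] [NormedSpace ℝ E] {X : Type*} [TopologicalSpace X]

/-- The open set `U ⊆ X` covered by a chart `(U, Ũ/Γ, π)`. -/
def source (c : OrbifoldChart.{w} E X) : Set X := Set.range c.proj

instance continuousConstSMul (c : OrbifoldChart.{w} E X) :
    ContinuousConstSMul c.group c.carrier :=
  ⟨fun γ => (c.smooth_smul γ).continuous⟩

theorem continuous_proj (c : OrbifoldChart.{w} E X) : Continuous c.proj :=
  c.isOpenEmbedding_quotient.continuous.comp continuous_quotient_mk'

theorem isOpenMap_proj (c : OrbifoldChart.{w} E X) : IsOpenMap c.proj :=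
  c.isOpenEmbedding_quotient.isOpenMap.comp isOpenMap_quotient_mk'_mul

theorem proj_eq_iff (c : OrbifoldChart.{w} E X) (p q : c.carrier) :
    c.proj p = c.proj q ↔ ∃ γ : c.group, γ • q = p := by
  constructor
  · intro h
    have h2 : (Quotient.mk (MulAction.orbitRel c.group c.carrier) p) = Quotient.mk _ q :=
      c.isOpenEmbedding_quotient.injective h
    exact Quotient.exact h2
  · rintro ⟨γ, rfl⟩
    exact c.proj_smul γ q

/-- An injection from the chart `c` to the chart `d`: a smooth embedding `λ` of the chart domains
such that `π_d ∘ λ = π_c`. (In particular, `c.source ⊆ d.source`.) -/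
structure IsInjection (c d : OrbifoldChart.{w} E X) (l : c.carrier → d.carrier) : Prop where
  isSmoothEmbedding : Manifold.IsSmoothEmbedding 𝓘(ℝ, E) 𝓘(ℝ, E) ∞ l
  proj_comp : ∀ p, d.proj (l p) = c.proj p

/-- Compatibility of two orbifold charts. -/
def Compatible (c d : OrbifoldChart.{w} E X) : Prop :=
  ∀ x ∈ c.source ∩ d.source, ∃ b : OrbifoldChart.{w} E X,
    x ∈ b.source ∧ b.source ⊆ c.source ∩ d.source ∧
    (∃ l : b.carrier → c.carrier, IsInjection b c l) ∧
    (∃ m : b.carrier → d.carrier, IsInjection b d m)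

end Basic

section Prod

variable {E E' : Type*} [NormedAddCommGroup E] [NormedSpace ℝ E]
  [NormedAddCommGroup E'] [NormedSpace ℝ E']
  {X X' : Type*} [TopologicalSpace X] [TopologicalSpace X']

/-- The product chart `(U × U', (Ũ × Ũ')/(Γ × Γ'), π × π')`, where `Γ × Γ'` acts
componentwise. -/
def prod (c : OrbifoldChart.{w} E X) (d : OrbifoldChart.{w} E' X') :
    OrbifoldChart.{w} (E × E') (X × X') :=
  letI act : MulAction (c.group × d.group) (c.carrier × d.carrier) :=
    { smul := fun γ p => (γ.1 • p.1, γ.2 • p.2)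
      one_smul := fun p => Prod.ext (one_smul _ p.1) (one_smul _ p.2)
      mul_smul := fun γ δ p => Prod.ext (mul_smul _ _ p.1) (mul_smul _ _ p.2) }
  { carrier := c.carrier × d.carrier
    chartedSpace := (inferInstance : ChartedSpace (ModelProd E E') (c.carrier × d.carrier))
    isManifold := by
      rw [modelWithCornersSelf_prod]
      exact (inferInstance :
        IsManifold (𝓘(ℝ, E).prod 𝓘(ℝ, E')) ∞ (c.carrier × d.carrier))
    group := c.group × d.group
    action := act
    effective := by
      refine ⟨fun {γ δ} h => ?_⟩
      obtain ⟨p⟩ := (inferInstance : Nonempty c.carrier)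
      obtain ⟨q⟩ := (inferInstance : Nonempty d.carrier)
      refine Prod.ext (FaithfulSMul.eq_of_smul_eq_smul (α := c.carrier) fun a => ?_)
        (FaithfulSMul.eq_of_smul_eq_smul (α := d.carrier) fun a => ?_)
      · exact congrArg Prod.fst (h (a, q))
      · exact congrArg Prod.snd (h (p, a))
    smooth_smul := fun γ => by
      rw [modelWithCornersSelf_prod]
      exact (c.smooth_smul γ.1).prodMap (d.smooth_smul γ.2)
    proj := Prod.map c.proj d.proj
    proj_smul := fun γ p => Prod.ext (c.proj_smul γ.1 p.1) (d.proj_smul γ.2 p.2)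
    isOpenEmbedding_quotient := by
      refine Topology.IsOpenEmbedding.of_continuous_injective_isOpenMap ?_ ?_ ?_
      · exact (c.continuous_proj.prodMap d.continuous_proj).quotient_lift _
      · rintro ⟨p⟩ ⟨q⟩ h
        obtain ⟨γ, hγ⟩ := (c.proj_eq_iff p.1 q.1).1 (congrArg Prod.fst h)
        obtain ⟨δ, hδ⟩ := (d.proj_eq_iff p.2 q.2).1 (congrArg Prod.snd h)
        exact Quotient.sound ⟨(γ, δ), Prod.ext hγ hδ⟩
      · intro O hO
        have h1 := (c.isOpenMap_proj.prodMap d.isOpenMap_proj) _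
          (hO.preimage continuous_quotient_mk')
        convert h1 using 1
        ext x
        constructor
        · rintro ⟨⟨p⟩, hp, rfl⟩
          exact ⟨p, hp, rfl⟩
        · rintro ⟨p, hp, rfl⟩
          exact ⟨_, hp, rfl⟩ }

end Prod

end OrbifoldChart

/-! ### Orbifolds -/

section Orbifold

variable {E E' : Type*} [NormedAddCommGroup E] [NormedSpace ℝ E]
  [NormedAddCommGroup E'] [NormedSpace ℝ E']
  {X X' : Type*} [TopologicalSpace X] [TopologicalSpace X']

/-- A family of charts is an orbifold atlas on `X` if the charts cover `X` and are pairwise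
compatible. -/
structure IsOrbifoldAtlas {ι : Type*} (c : ι → OrbifoldChart.{w} E X) : Prop where
  cover : ⋃ i, (c i).source = Set.univ
  compatible : ∀ i j, (c i).Compatible (c j)

variable (E X) in
/-- An orbifold structure on `X`, of dimension `dim E`: a maximal orbifold atlas. -/
structure Orbifold where
  charts : Set (OrbifoldChart.{w} E X)
  isOrbifoldAtlas : IsOrbifoldAtlas (fun c : charts => (c : OrbifoldChart.{w} E X))
  maximal : ∀ c : OrbifoldChart.{w} E X, (∀ d ∈ charts, c.Compatible d) → c ∈ charts

namespace Orbifold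

/-- The maximal atlas `𝒜 × 𝒜'` of the product orbifold: it consists of all charts on `X × X'` which
are compatible with all products of a chart in `𝒜` and a chart in `𝒜'`. -/
def prodCharts (O : Orbifold.{w} E X) (O' : Orbifold.{w} E' X') :
    Set (OrbifoldChart.{w} (E × E') (X × X')) :=
  {c | ∀ d ∈ O.charts, ∀ d' ∈ O'.charts, c.Compatible (d.prod d')}

/-- `x` is a regular point: the isotropy group `Γ_p` of a point `p` over `x` in a chart around `x`
is trivial. (Up to isomorphism, `Γ_p` depends neither on the chart nor on `p`.) -/
def IsRegularPoint (O : Orbifold.{w} E X) (x : X) : Prop :=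
  ∀ c ∈ O.charts, ∀ p : c.carrier, c.proj p = x → MulAction.stabilizer c.group p = ⊥

/-- The singular strata have codimension at least two. The stratum of a point `x` consists of the
points with the same isotropy (up to isomorphism) as `x`. In a chart it lifts, around a point `p`
over `x`, to the set of all `q` with `Γ_q ≃ Γ_p`. For every singular `x` this has to be,
around `p`, a submanifold whose dimension is at most `dim X - 2`. -/
def SingularStrataCodimAtLeastTwo (O : Orbifold.{w} E X) : Prop :=
  ∀ c ∈ O.charts, ∀ p : c.carrier, MulAction.stabilizer c.group p ≠ ⊥ →
    ∃ k : ℕ, k + 2 ≤ Module.finrank ℝ E ∧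
      IsSubmanifoldAt E k {q : c.carrier | Nonempty
        (MulAction.stabilizer c.group q ≃* MulAction.stabilizer c.group p)} p

/-- A smooth map between orbifolds: a continuous map which around every point has a smooth
equivariant lift with respect to suitable charts. -/
def IsSmoothMap (O : Orbifold.{w} E X) (O' : Orbifold.{w} E' X') (f : X → X') : Prop :=
  Continuous f ∧ ∀ x : X, ∃ c ∈ O.charts, ∃ c' ∈ O'.charts, x ∈ c.source ∧ f x ∈ c'.source ∧
    ∃ (F : c.carrier → c'.carrier) (φ : c.group →* c'.group),
      ContMDiff 𝓘(ℝ, E) 𝓘(ℝ, E') ∞ F ∧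
      (∀ p, c'.proj (F p) = f (c.proj p)) ∧
      (∀ γ p, F (γ • p) = φ γ • F p)

end Orbifold

/-! ### Suborbifolds -/

/-- A closed `k`-dimensional suborbifold cover `(V j)_{j ∈ J}` on `Y ⊆ X` with respect to the atlas
`c`: each `V j` is a connected closed subset of the domain of the `j`-th chart, it is a
`k`-dimensional `Δ`-submanifold for some subgroup `Δ` of the group of this chart, its image
in `X` is an open subset of `Y`, and these images cover `Y`. -/
structure IsClosedSuborbifoldCover {ι : Type*} (c : ι → OrbifoldChart.{w} E X) (k : ℕ) (J : Set ι)
    (V : (j : J) → Set (c j).carrier) (Y : Set X) : Prop where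
  isConnected : ∀ j : J, IsConnected (V j)
  isGroupSubmanifold : ∀ j : J, ∃ Δ : Subgroup (c j).group, IsGroupSubmanifold E k Δ (V j)
  isOpen_image : ∀ j : J, ∃ O : Set X, IsOpen O ∧ (c j).proj '' V j = O ∩ Y
  cover : ⋃ j : J, (c j).proj '' V j = Y
  isClosed : ∀ j : J, IsClosed (V j)

/-- A regular suborbifold cover: a closed suborbifold cover such that in every `V j` the points
with trivial isotropy form a connected dense subset. -/
structure IsRegularSuborbifoldCover {ι : Type*} (c : ι → OrbifoldChart.{w} E X) (k : ℕ) (J : Set ι)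
    (V : (j : J) → Set (c j).carrier) (Y : Set X) : Prop
    extends IsClosedSuborbifoldCover c k J V Y where
  dense : ∀ j : J, V j ⊆ closure {p ∈ V j | MulAction.stabilizer (c j).group p = ⊥}
  connected : ∀ j : J, IsConnected {p ∈ V j | MulAction.stabilizer (c j).group p = ⊥}

/-- A very strong suborbifold cover. -/
structure IsVeryStrongSuborbifoldCover {ι : Type*} (c : ι → OrbifoldChart.{w} E X) (k : ℕ)
    (J : Set ι) (V : (j : J) → Set (c j).carrier) (Y : Set X) : Prop
    extends IsClosedSuborbifoldCover c k J V Y where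
  eq_one_of_fixes_open : ∀ (j : J) (γ : (c j).group) (O : Set (c j).carrier), IsOpen O →
    (O ∩ V j).Nonempty → (∀ p ∈ O ∩ V j, γ • p = p) → γ = 1
  exists_common_chart : ∀ i j : J, ∀ x ∈ (c i).proj '' V i ∩ (c j).proj '' V j,
    ∃ (b : OrbifoldChart.{w} E X) (L : Subgroup b.group) (Z : Set b.carrier),
      IsGroupSubmanifold E k L Z ∧ x ∈ b.proj '' Z ∧
      (∃ O : Set X, IsOpen O ∧ b.proj '' Z = O ∩ Y) ∧
      (∃ l : b.carrier → (c i).carrier, b.IsInjection (c i) l ∧ Set.MapsTo l Z (V i)) ∧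
      (∃ m : b.carrier → (c j).carrier, b.IsInjection (c j) m ∧ Set.MapsTo m Z (V j))

/-- `Y` is a regular suborbifold of the orbifold with maximal atlas `𝒜`: it admits a regular
suborbifold cover with respect to some countable atlas contained in `𝒜`. -/
def IsRegularSuborbifold (𝒜 : Set (OrbifoldChart.{w} E X)) (Y : Set X) : Prop :=
  ∃ (ι : Type) (_ : Countable ι) (c : ι → OrbifoldChart.{w} E X),
    IsOrbifoldAtlas c ∧ (∀ i, c i ∈ 𝒜) ∧
    ∃ (k : ℕ) (J : Set ι) (V : (j : J) → Set (c j).carrier), IsRegularSuborbifoldCover c k J V Y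

/-- `Y` is a very strong suborbifold of the orbifold with maximal atlas `𝒜`: it admits a very strong
suborbifold cover with respect to some countable atlas contained in `𝒜`. -/
def IsVeryStrongSuborbifold (𝒜 : Set (OrbifoldChart.{w} E X)) (Y : Set X) : Prop :=
  ∃ (ι : Type) (_ : Countable ι) (c : ι → OrbifoldChart.{w} E X),
    IsOrbifoldAtlas c ∧ (∀ i, c i ∈ 𝒜) ∧
    ∃ (k : ℕ) (J : Set ι) (V : (j : J) → Set (c j).carrier),
      IsVeryStrongSuborbifoldCover c k J V Y

end Orbifold

end

noncomputable section

/-! ### Connectedness of complements of sets of codimension at least two -/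

/-! Over a chart, the graph of `f` lifts to the graph of an equivariant smooth map `F : Ũ → Ũ'`.
That graph is a closed connected submanifold of `Ũ × Ũ'`. It is a `Δ`-submanifold for `Δ` the graph
of the homomorphism `φ`, and it projects onto the part of the graph of `f` over `U`. By Lindelöf,
countably many lifts suffice.

The isotropy at `(p, F p)` is `Γ_p × Γ'_{F p}`. As `f` preserves regular points, it is trivial
exactly when `Γ_p` is, so the regular points of the lifted graph are the image of those of `Ũ` under
`p ↦ (p, F p)`. Regularity of the cover therefore reduces to `isConnected_dense_regularSet`: the
regular points of a chart are connected and dense. This is where codimension two enters: the strata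
are removed in decreasing order of isotropy, and near each removed point this deletes a slice of
codimension at least two, whose complement in a ball is connected. Applying the hypothesis on `f`
also requires that trivial isotropy in one chart forces it in all
(`isRegularPoint_of_stabilizer_eq_bot`).

For the diagonal, only squares of charts with `F = id` are used. Density of the regular points gives
condition (1), and squares of injections preserve diagonals, which gives condition (2). -/

theorem IsPreconnected.of_dense_of_local {T : Type*} [TopologicalSpace T] {U D : Set T}
    (hU : IsPreconnected U) (hDU : D ⊆ U) (hUD : U ⊆ closure D)
    (hloc : ∀ p ∈ U \ D, ∃ N : Set T, IsOpen N ∧ p ∈ N ∧ IsPreconnected (N ∩ D)) :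
    IsPreconnected D := by
  intro u v hu hv huv hDu hDv
  have hcl : U ⊆ closure (D ∩ u) ∪ closure (D ∩ v) := by
    rw [← closure_union, ← Set.inter_union_distrib_left, Set.inter_eq_left.2 huv]
    exact hUD
  -- Connectedness of `U` yields a point adherent to both halves of `D`. If it lies in `D`, openness
  -- of `u` or `v` puts a point of `D` in both; otherwise the connected set `N ∩ D` meets both
  -- halves.
  obtain ⟨p, hpU, hpu, hpv⟩ := isPreconnected_closed_iff.1 hU _ _ isClosed_closure isClosed_closure
    hcl (hDu.mono fun x hx => ⟨hDU hx.1, subset_closure hx⟩)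
    (hDv.mono fun x hx => ⟨hDU hx.1, subset_closure hx⟩)
  by_cases hpD : p ∈ D
  · rcases huv hpD with h | h
    · obtain ⟨x, hxu, hxD, hxv⟩ := mem_closure_iff.1 hpv u hu h
      exact ⟨x, hxD, hxu, hxv⟩
    · obtain ⟨x, hxv, hxD, hxu⟩ := mem_closure_iff.1 hpu v hv h
      exact ⟨x, hxD, hxu, hxv⟩
  · obtain ⟨N, hN, hpN, hc⟩ := hloc p ⟨hpU, hpD⟩
    obtain ⟨x, hxN, hxD, hxu⟩ := mem_closure_iff.1 hpu N hN hpN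
    obtain ⟨y, hyN, hyD, hyv⟩ := mem_closure_iff.1 hpv N hN hpN
    obtain ⟨z, hz, hzuv⟩ := hc u v hu hv (fun z hz => huv hz.2) ⟨x, ⟨hxN, hxD⟩, hxu⟩
      ⟨y, ⟨hyN, hyD⟩, hyv⟩
    exact ⟨z, hz.2, hzuv⟩

section Codim

variable {E : Type*} [NormedAddCommGroup E] [NormedSpace ℝ E]

/-- `univBall` is a positive rescaling followed by translation by `a ∈ F`, so this homeomorphism of
`E` onto the ball respects `F` and reduces a ball minus `F` to the whole complement of `F`. -/
theorem univBall_mem_submodule_iff {F : Submodule ℝ E} {a : E} (ha : a ∈ F) {r : ℝ} (hr : 0 < r)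
    (x : E) : OpenPartialHomeomorph.univBall a r x ∈ F ↔ x ∈ F := by
  have h : OpenPartialHomeomorph.univBall a r x = r • ((√(1 + ‖x‖ ^ 2))⁻¹ • x) + a := by
    rw [OpenPartialHomeomorph.univBall, dif_pos hr]
    rfl
  have h1 : (√(1 + ‖x‖ ^ 2))⁻¹ ≠ 0 := by positivity
  rw [h, F.add_mem_iff_left ha, F.smul_mem_iff hr.ne', F.smul_mem_iff h1]

theorem isConnected_ball_diff_submodule [FiniteDimensional ℝ E] {F : Submodule ℝ E}
    (hF : Module.finrank ℝ F + 2 ≤ Module.finrank ℝ E) {a : E} (ha : a ∈ F) {r : ℝ} (hr : 0 < r) :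
    IsConnected (Metric.ball a r \ F) := by
  have hcodim : 1 < Module.rank ℝ (E ⧸ F) := by
    rw [← Module.finrank_eq_rank]
    have := F.finrank_quotient_add_finrank
    exact_mod_cast (by omega : 1 < Module.finrank ℝ (E ⧸ F))
  have h := (isConnected_compl_of_one_lt_codim hcodim).image
    (OpenPartialHomeomorph.univBall a r) (OpenPartialHomeomorph.continuous_univBall a r).continuousOn
  convert h using 1
  ext y
  constructor
  · rintro ⟨hy, hyF⟩
    rw [← OpenPartialHomeomorph.univBall_target a hr] at hy
    refine ⟨(OpenPartialHomeomorph.univBall a r).symm y, ?_,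
      (OpenPartialHomeomorph.univBall a r).right_inv hy⟩
    rwa [Set.mem_compl_iff, SetLike.mem_coe, ← univBall_mem_submodule_iff ha hr,
      (OpenPartialHomeomorph.univBall a r).right_inv hy]
  · rintro ⟨x, hx, rfl⟩
    refine ⟨?_, fun h => hx ((univBall_mem_submodule_iff ha hr x).1 h)⟩
    rw [← OpenPartialHomeomorph.univBall_target a hr]
    exact (OpenPartialHomeomorph.univBall a r).map_source (by simp)

theorem IsSubmanifoldAt.exists_isConnected_diff [FiniteDimensional ℝ E] {M : Type*}
    [TopologicalSpace M] [ChartedSpace E M] {k : ℕ} {S : Set M} {p : M}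
    (hS : IsSubmanifoldAt E k S p) (hk : k + 2 ≤ Module.finrank ℝ E) (hpS : p ∈ S)
    {O : Set M} (hO : IsOpen O) (hp : p ∈ O) :
    ∃ N ⊆ O, IsOpen N ∧ p ∈ N ∧ IsConnected (N \ S) := by
  obtain ⟨φ, -, hpφ, F, rfl, hF⟩ := hS
  have ho : IsOpen (φ.target ∩ φ.symm ⁻¹' O) := φ.isOpen_inter_preimage_symm hO
  have hmem : φ p ∈ φ.target ∩ φ.symm ⁻¹' O :=
    ⟨φ.map_source hpφ, by simpa [φ.left_inv hpφ] using hp⟩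
  obtain ⟨r, hr, hball⟩ := Metric.isOpen_iff.1 ho _ hmem
  have hbt : Metric.ball (φ p) r ⊆ φ.target := fun x hx => (hball hx).1
  refine ⟨φ.symm '' Metric.ball (φ p) r, ?_, ?_, ?_, ?_⟩
  · rintro _ ⟨x, hx, rfl⟩
    exact (hball hx).2
  · exact φ.symm.isOpen_image_of_subset_source Metric.isOpen_ball hbt
  · exact ⟨φ p, Metric.mem_ball_self hr, φ.left_inv hpφ⟩
  · have h := (isConnected_ball_diff_submodule hk ((hF p hpφ).1 hpS) hr).image φ.symm
      (φ.symm.continuousOn.mono fun x hx => hbt hx.1)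
    convert h using 1
    ext q
    constructor
    · rintro ⟨⟨x, hx, rfl⟩, hq⟩
      rw [hF _ (φ.map_target (hbt hx)), φ.right_inv (hbt hx)] at hq
      exact ⟨x, ⟨hx, hq⟩, rfl⟩
    · rintro ⟨x, hx, rfl⟩
      refine ⟨⟨x, hx.1, rfl⟩, fun hq => hx.2 ?_⟩
      rwa [hF _ (φ.map_target (hbt hx.1)), φ.right_inv (hbt hx.1)] at hq

end Codim

/-! ### The set of regular points of a chart -/

/-- An element that moves `p` moves every nearby point, and there are only finitely many elements.
-/
theorem eventually_stabilizer_le {G M : Type*} [Group G] [Finite G] [TopologicalSpace M] [T2Space M]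
    [MulAction G M] [ContinuousConstSMul G M] (p : M) :
    ∀ᶠ q in 𝓝 p, MulAction.stabilizer G q ≤ MulAction.stabilizer G p := by
  have h : ∀ g : G, ∀ᶠ q in 𝓝 p, g ∈ MulAction.stabilizer G q → g ∈ MulAction.stabilizer G p := by
    intro g
    by_cases hg : g • p = p
    · exact Filter.Eventually.of_forall fun q _ => hg
    · have : IsOpen {q : M | g • q ≠ q} := isOpen_ne_fun (continuous_const_smul g) continuous_id
      filter_upwards [this.mem_nhds hg] with q hq hgq
      exact absurd hgq hq
  filter_upwards [Filter.eventually_all.2 h] with q hq g hg using hq g hg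

namespace OrbifoldChart

variable {E : Type*} [NormedAddCommGroup E] [NormedSpace ℝ E] {X : Type*} [TopologicalSpace X]

/-- The points of the domain of a chart with trivial isotropy. -/
def regularSet (c : OrbifoldChart.{w} E X) : Set c.carrier :=
  {p | MulAction.stabilizer c.group p = ⊥}

/-- Descending induction on the bound `k` for the isotropy order: `j` counts the steps down from
`|Γ|`, where nothing is removed. Passing from `k + 1` to `k` removes the points with isotropy of
order exactly `k + 1`; since `k ≥ 1` they are singular, so the codimension hypothesis applies. -/
theorem isConnected_dense_card_stabilizer_le [FiniteDimensional ℝ E] (c : OrbifoldChart.{w} E X)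
    (hc : ∀ p : c.carrier, MulAction.stabilizer c.group p ≠ ⊥ →
      ∃ k : ℕ, k + 2 ≤ Module.finrank ℝ E ∧ IsSubmanifoldAt E k {q : c.carrier | Nonempty
        (MulAction.stabilizer c.group q ≃* MulAction.stabilizer c.group p)} p)
    (j k : ℕ) (hk : 1 ≤ k) (hjk : k + j = Nat.card c.group) :
    IsPreconnected {p : c.carrier | Nat.card (MulAction.stabilizer c.group p) ≤ k} ∧
      Dense {p : c.carrier | Nat.card (MulAction.stabilizer c.group p) ≤ k} := by
  induction j generalizing k with
  | zero =>
    have : {p : c.carrier | Nat.card (MulAction.stabilizer c.group p) ≤ k} = Set.univ := by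
      refine Set.eq_univ_of_forall fun p => ?_
      rw [Set.mem_ofPred_eq, show k = Nat.card c.group by omega]
      exact Subgroup.card_le_card_group _
    rw [this]
    exact ⟨isPreconnected_univ, dense_univ⟩
  | succ j ih =>
    obtain ⟨ihc, ihd⟩ := ih (k + 1) (by omega) (by omega)
    have key : ∀ p : c.carrier, Nat.card (MulAction.stabilizer c.group p) = k + 1 →
        ∀ O : Set c.carrier, IsOpen O → p ∈ O → ∃ N ⊆ O, IsOpen N ∧ p ∈ N ∧
          IsConnected (N ∩ {q | Nat.card (MulAction.stabilizer c.group q) ≤ k}) := by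
      intro p hp O hO hpO
      have hne : MulAction.stabilizer c.group p ≠ ⊥ := by
        intro h
        rw [h, Subgroup.card_bot] at hp
        omega
      obtain ⟨d, hd, hS⟩ := hc p hne
      obtain ⟨W, hW, hWo, hpW⟩ := eventually_nhds_iff.1 (eventually_stabilizer_le (G := c.group) p)
      obtain ⟨N, hNO, hN, hpN, hcon⟩ :=
        hS.exists_isConnected_diff hd ⟨MulEquiv.refl _⟩ (hO.inter hWo) ⟨hpO, hpW⟩
      refine ⟨N, fun q hq => (hNO hq).1, hN, hpN, ?_⟩
      convert hcon using 1
      ext q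
      refine and_congr_right fun hq => ?_
      -- On `N` every `Γ_q` is a subgroup of `Γ_p`, so order above `k` means `Γ_q = Γ_p`, and this
      -- is the same as `Γ_q ≃ Γ_p`: the removed points of `N` are exactly the stratum.
      have hle := hW q (hNO hq).2
      rw [Set.mem_ofPred_eq, Set.mem_ofPred_eq, ← not_iff_not, not_not, not_le]
      constructor
      · intro hlt
        have : MulAction.stabilizer c.group q = MulAction.stabilizer c.group p :=
          Subgroup.eq_of_le_of_card_ge hle (by omega)
        exact ⟨MulEquiv.subgroupCongr this⟩
      · rintro ⟨e⟩
        rw [Nat.card_congr e.toEquiv]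
        omega
    have hcard : ∀ p ∈ {p : c.carrier | Nat.card (MulAction.stabilizer c.group p) ≤ k + 1} \
        {p | Nat.card (MulAction.stabilizer c.group p) ≤ k},
        Nat.card (MulAction.stabilizer c.group p) = k + 1 := by
      rintro p ⟨h1, h2⟩
      simp only [Set.mem_ofPred_eq] at h1 h2
      omega
    have hcl : {p : c.carrier | Nat.card (MulAction.stabilizer c.group p) ≤ k + 1} ⊆
        closure {p | Nat.card (MulAction.stabilizer c.group p) ≤ k} := by
      intro p hp
      by_cases h : Nat.card (MulAction.stabilizer c.group p) ≤ k
      · exact subset_closure h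
      · refine mem_closure_iff.2 fun O hO hpO => ?_
        obtain ⟨N, hNO, -, -, hcon⟩ := key p (hcard p ⟨hp, h⟩) O hO hpO
        exact hcon.nonempty.mono fun q hq => ⟨hNO hq.1, hq.2⟩
    refine ⟨ihc.of_dense_of_local (fun p hp => Nat.le_succ_of_le hp) hcl fun p hp => ?_, ?_⟩
    · obtain ⟨N, -, hN, hpN, hcon⟩ := key p (hcard p hp) Set.univ isOpen_univ trivial
      exact ⟨N, hN, hpN, hcon.isPreconnected⟩
    · exact (ihd.mono hcl).of_closure

theorem isConnected_dense_regularSet [FiniteDimensional ℝ E] {O : Orbifold.{w} E X}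
    (hO : O.SingularStrataCodimAtLeastTwo) {c : OrbifoldChart.{w} E X} (hc : c ∈ O.charts) :
    IsConnected c.regularSet ∧ Dense c.regularSet := by
  have hpos : 0 < Nat.card c.group := Nat.card_pos
  have h := c.isConnected_dense_card_stabilizer_le (hO c hc) (Nat.card c.group - 1) 1 le_rfl
    (by omega)
  have hs : {p : c.carrier | Nat.card (MulAction.stabilizer c.group p) ≤ 1} = c.regularSet := by
    ext p
    exact Subgroup.card_le_one_iff_eq_bot _
  rw [hs] at h
  exact ⟨⟨h.2.nonempty, h.1⟩, h.2⟩

theorem eq_one_of_smul_eq_on_open {c : OrbifoldChart.{w} E X} (hd : Dense c.regularSet)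
    {γ : c.group} {O : Set c.carrier} (hO : IsOpen O) (hne : O.Nonempty)
    (h : ∀ p ∈ O, γ • p = p) : γ = 1 := by
  obtain ⟨p, hpO, hp⟩ := hd.inter_open_nonempty O hO hne
  have : γ ∈ MulAction.stabilizer c.group p := h p hpO
  rwa [hp, Subgroup.mem_bot] at this

end OrbifoldChart

/-! ### Immersions between manifolds of the same dimension -/

/-- In suitable charts an immersion is an injective linear map; between spaces of equal finite
dimension that is an isomorphism, so the immersion is open at `x`. -/
theorem Manifold.IsImmersionAt.map_nhds_eq {E : Type*} [NormedAddCommGroup E] [NormedSpace ℝ E]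
    [FiniteDimensional ℝ E] {M N : Type*} [TopologicalSpace M] [ChartedSpace E M]
    [TopologicalSpace N] [ChartedSpace E N] {f : M → N} {x : M}
    (h : Manifold.IsImmersionAt 𝓘(ℝ, E) 𝓘(ℝ, E) ∞ f x) : (𝓝 x).map f = 𝓝 (f x) := by
  let l : E →ₗ[ℝ] E := h.equiv.toLinearEquiv.toLinearMap.comp (LinearMap.inl ℝ E h.complement)
  have hl : Function.Injective l := h.equiv.injective.comp LinearMap.inl_injective
  let e : E ≃L[ℝ] E := (LinearEquiv.ofInjectiveEndo l hl).toContinuousLinearEquiv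
  have hf : ∀ y ∈ h.domChart.source, h.codChart (f y) = e (h.domChart y) := by
    intro y hy
    have hy' : h.domChart y ∈ (h.domChart.extend 𝓘(ℝ, E)).target := by
      simpa using h.domChart.map_source hy
    have := h.writtenInCharts hy'
    simpa [h.domChart.left_inv hy, e, l] using this
  have hf' : f =ᶠ[𝓝 x] h.codChart.symm ∘ e ∘ h.domChart := by
    filter_upwards [h.domChart.open_source.mem_nhds h.mem_domChart_source] with y hy
    simp only [Function.comp_apply, ← hf y hy]
    exact (h.codChart.left_inv (h.source_subset_preimage_source hy)).symm
  have he : e (h.domChart x) ∈ h.codChart.symm.source := by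
    rw [← hf x h.mem_domChart_source]
    exact h.codChart.map_source h.mem_codChart_source
  rw [Filter.map_congr hf', ← Filter.map_map, ← Filter.map_map,
    h.domChart.map_nhds_eq h.mem_domChart_source,
    show Filter.map e (𝓝 (h.domChart x)) = 𝓝 (e (h.domChart x)) from
      e.toHomeomorph.map_nhds_eq _, h.codChart.symm.map_nhds_eq he, hf'.self_of_nhds]
  rfl

namespace OrbifoldChart

section Injection

variable {E : Type*} [NormedAddCommGroup E] [NormedSpace ℝ E] {X : Type*} [TopologicalSpace X]

theorem IsInjection.map_nhds_eq [FiniteDimensional ℝ E] {c d : OrbifoldChart.{w} E X}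
    {l : c.carrier → d.carrier} (h : c.IsInjection d l) (p : c.carrier) :
    (𝓝 p).map l = 𝓝 (l p) :=
  (h.isSmoothEmbedding.isImmersion.isImmersionAt p).map_nhds_eq

theorem stabilizer_eq_bot_of_proj_eq {c : OrbifoldChart.{w} E X} {p q : c.carrier}
    (hpq : c.proj p = c.proj q) (hp : MulAction.stabilizer c.group p = ⊥) :
    MulAction.stabilizer c.group q = ⊥ := by
  obtain ⟨γ, rfl⟩ := (c.proj_eq_iff q p).1 hpq.symm
  rw [MulAction.stabilizer_smul_eq_stabilizer_map_conj, hp, Subgroup.map_bot]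

/-- The charts are compared through a common chart `b` with injections `l` and `m`. If `γ` fixes `m
r`, then near `r` it sends `m s` to some `m s'` with `s'` near `r`. The points `l s` and `l s'` lie
in one orbit near a point with trivial isotropy, so they coincide. Thus `γ` is the identity on an
open set, hence trivial. -/
theorem isRegularPoint_of_stabilizer_eq_bot [FiniteDimensional ℝ E] {O : Orbifold.{w} E X}
    (hO : O.SingularStrataCodimAtLeastTwo) {c : OrbifoldChart.{w} E X} (hc : c ∈ O.charts)
    {p : c.carrier} (hp : MulAction.stabilizer c.group p = ⊥) : O.IsRegularPoint (c.proj p) := by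
  intro d hd q hq
  obtain ⟨b, ⟨r, hr⟩, -, ⟨l, hl⟩, ⟨m, hm⟩⟩ :=
    O.isOrbifoldAtlas.compatible ⟨c, hc⟩ ⟨d, hd⟩ (c.proj p) ⟨⟨p, rfl⟩, ⟨q, hq⟩⟩
  have hlr : MulAction.stabilizer c.group (l r) = ⊥ :=
    stabilizer_eq_bot_of_proj_eq (by rw [hl.proj_comp, hr]) hp
  refine stabilizer_eq_bot_of_proj_eq (p := m r) (by rw [hm.proj_comp, hr, hq]) ?_
  refine (Subgroup.eq_bot_iff_forall _).2 fun γ (hγ : γ • m r = m r) => ?_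
  have hmc := hm.isSmoothEmbedding.isEmbedding.continuous
  have hlc := hl.isSmoothEmbedding.isEmbedding.continuous
  have h1 : ∀ g : c.group, g ≠ 1 → ∀ᶠ z : b.carrier × b.carrier in 𝓝 (r, r),
      g • l z.1 ≠ l z.2 := by
    intro g hg
    have ho : IsOpen {z : b.carrier × b.carrier | g • l z.1 ≠ l z.2} :=
      isOpen_ne_fun ((hlc.comp continuous_fst).const_smul g) (hlc.comp continuous_snd)
    refine ho.mem_nhds fun h => hg ?_
    rw [← Subgroup.mem_bot, ← hlr]
    exact h
  -- Finiteness of the group gives one neighbourhood of `(r, r)` that serves all `g ≠ 1`.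
  have h2 : ∀ᶠ z : b.carrier × b.carrier in 𝓝 (r, r), ∀ g : c.group, g ≠ 1 → g • l z.1 ≠ l z.2 :=
    Filter.eventually_all.2 fun g => Filter.eventually_imp_distrib_left.2 (h1 g)
  rw [nhds_prod_eq] at h2
  obtain ⟨P, hP, Q, hQ, hPQ⟩ := Filter.eventually_prod_iff.1 h2
  have h3 : ∀ᶠ y in 𝓝 (m r), γ • y ∈ m '' {s | Q s} := by
    have : Filter.Tendsto (fun y : d.carrier => γ • y) (𝓝 (m r)) (𝓝 (m r)) := by
      have := (continuous_const_smul (T := d.carrier) γ).tendsto (m r)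
      rwa [hγ] at this
    refine this.eventually_mem ?_
    rw [← hm.map_nhds_eq]
    exact Filter.image_mem_map hQ
  have h4 : ∀ᶠ s in 𝓝 r, γ • m s = m s := by
    filter_upwards [hP, hmc.continuousAt.eventually h3] with s hs hs3
    obtain ⟨s', hs', hss'⟩ := hs3
    have hpr : c.proj (l s') = c.proj (l s) := by
      rw [hl.proj_comp, hl.proj_comp, ← hm.proj_comp, ← hm.proj_comp, hss', d.proj_smul]
    obtain ⟨g, hg⟩ := (c.proj_eq_iff _ _).1 hpr
    have hg1 : g = 1 := by
      by_contra hne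
      exact hPQ hs hs' g hne hg
    rw [hg1, one_smul] at hg
    rw [← hss', hl.isSmoothEmbedding.isEmbedding.injective hg]
  have h5 : ∀ᶠ y in 𝓝 (m r), γ • y = y := by
    rw [← hm.map_nhds_eq]
    exact h4
  obtain ⟨W, hW, hWo, hrW⟩ := eventually_nhds_iff.1 h5
  exact eq_one_of_smul_eq_on_open (isConnected_dense_regularSet hO hd).2 hWo ⟨_, hrW⟩ hW

end Injection

section Prod

variable {E E' : Type*} [NormedAddCommGroup E] [NormedSpace ℝ E]
  [NormedAddCommGroup E'] [NormedSpace ℝ E']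
  {X X' : Type*} [TopologicalSpace X] [TopologicalSpace X']

theorem source_prod (c : OrbifoldChart.{w} E X) (d : OrbifoldChart.{w} E' X') :
    (c.prod d).source = c.source ×ˢ d.source :=
  Set.range_prodMap

theorem IsInjection.prod {b c : OrbifoldChart.{w} E X} {b' c' : OrbifoldChart.{w} E' X'}
    {l : b.carrier → c.carrier} {l' : b'.carrier → c'.carrier} (h : b.IsInjection c l)
    (h' : b'.IsInjection c' l') : (b.prod b').IsInjection (c.prod c') (Prod.map l l') where
  isSmoothEmbedding := by
    rw [modelWithCornersSelf_prod]
    exact h.isSmoothEmbedding.prodMap h'.isSmoothEmbedding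
  proj_comp p := Prod.ext (h.proj_comp p.1) (h'.proj_comp p.2)

theorem Compatible.prod {c d : OrbifoldChart.{w} E X} {c' d' : OrbifoldChart.{w} E' X'}
    (h : c.Compatible d) (h' : c'.Compatible d') : (c.prod c').Compatible (d.prod d') := by
  rintro ⟨x, x'⟩ hx
  rw [source_prod, source_prod] at hx
  obtain ⟨b, hxb, hb, ⟨l, hl⟩, ⟨m, hm⟩⟩ := h x ⟨hx.1.1, hx.2.1⟩
  obtain ⟨b', hxb', hb', ⟨l', hl'⟩, ⟨m', hm'⟩⟩ := h' x' ⟨hx.1.2, hx.2.2⟩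
  refine ⟨b.prod b', ?_, ?_, ⟨_, hl.prod hl'⟩, ⟨_, hm.prod hm'⟩⟩
  · rw [source_prod]
    exact ⟨hxb, hxb'⟩
  · rw [source_prod, source_prod, source_prod]
    exact fun z hz => ⟨⟨(hb hz.1).1, (hb' hz.2).1⟩, ⟨(hb hz.1).2, (hb' hz.2).2⟩⟩

theorem prod_mem_prodCharts {O : Orbifold.{w} E X} {O' : Orbifold.{w} E' X'}
    {c : OrbifoldChart.{w} E X} {c' : OrbifoldChart.{w} E' X'} (hc : c ∈ O.charts)
    (hc' : c' ∈ O'.charts) : c.prod c' ∈ O.prodCharts O' := fun d hd d' hd' =>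
  (O.isOrbifoldAtlas.compatible ⟨c, hc⟩ ⟨d, hd⟩).prod
    (O'.isOrbifoldAtlas.compatible ⟨c', hc'⟩ ⟨d', hd'⟩)

end Prod

end OrbifoldChart

/-! ### Graphs of smooth maps -/

section Graph

variable {E E' : Type*} [NormedAddCommGroup E] [NormedSpace ℝ E]
  [NormedAddCommGroup E'] [NormedSpace ℝ E']
  {M M' : Type*} [TopologicalSpace M] [ChartedSpace E M] [TopologicalSpace M'] [ChartedSpace E' M']

/-- The slice chart `(p, q) ↦ (φ p, ψ q - ψ (F p))` for the graph of `F`, built from charts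
`φ` and `ψ`. -/
def graphSliceChart (φ : OpenPartialHomeomorph M E) (ψ : OpenPartialHomeomorph M' E') (F : M → M')
    (hF : Continuous F) : OpenPartialHomeomorph (M × M') (E × E') where
  toFun z := (φ z.1, ψ z.2 - ψ (F z.1))
  invFun y := (φ.symm y.1, ψ.symm (y.2 + ψ (F (φ.symm y.1))))
  source := (φ.source ∩ F ⁻¹' ψ.source) ×ˢ ψ.source
  target := ((φ.target ∩ φ.symm ⁻¹' (F ⁻¹' ψ.source)) ×ˢ Set.univ) ∩
    (fun y : E × E' => y.2 + ψ (F (φ.symm y.1))) ⁻¹' ψ.target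
  map_source' := by
    rintro ⟨p, q⟩ ⟨⟨hp, hFp⟩, hq⟩
    have := ψ.map_source hq
    simp_all
  map_target' := by
    rintro ⟨u, v⟩ ⟨⟨⟨hu, hFu⟩, -⟩, hv⟩
    exact ⟨⟨φ.map_target hu, hFu⟩, ψ.map_target hv⟩
  left_inv' := by
    rintro ⟨p, q⟩ ⟨⟨hp, hFp⟩, hq⟩
    simp_all
  right_inv' := by
    rintro ⟨u, v⟩ ⟨⟨⟨hu, hFu⟩, -⟩, hv⟩
    simp_all
  open_source := (φ.open_source.inter (ψ.open_source.preimage hF)).prod ψ.open_source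
  open_target := by
    refine ContinuousOn.isOpen_inter_preimage ?_
      ((φ.isOpen_inter_preimage_symm (ψ.open_source.preimage hF)).prod isOpen_univ) ψ.open_target
    refine continuousOn_snd.add (ψ.continuousOn.comp
      (hF.comp_continuousOn (φ.symm.continuousOn.comp continuousOn_fst ?_)) ?_)
    · exact fun y hy => hy.1.1
    · exact fun y hy => hy.1.2
  continuousOn_toFun := by
    refine (φ.continuousOn.comp continuousOn_fst fun z hz => hz.1.1).prodMk
      ((ψ.continuousOn.comp continuousOn_snd fun z hz => hz.2).sub
        (ψ.continuousOn.comp (hF.comp_continuousOn continuousOn_fst) fun z hz => hz.1.2))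
  continuousOn_invFun := by
    have h : ContinuousOn (fun y : E × E' => φ.symm y.1)
        (((φ.target ∩ φ.symm ⁻¹' (F ⁻¹' ψ.source)) ×ˢ Set.univ) ∩
          (fun y : E × E' => y.2 + ψ (F (φ.symm y.1))) ⁻¹' ψ.target) :=
      φ.symm.continuousOn.comp continuousOn_fst fun y hy => hy.1.1.1
    refine h.prodMk (ψ.symm.continuousOn.comp (continuousOn_snd.add
      (ψ.continuousOn.comp (hF.comp_continuousOn h) ?_)) ?_)
    · exact fun y hy => hy.1.1.2
    · exact fun y hy => hy.2

theorem graphSliceChart_mem_maximalAtlas [IsManifold 𝓘(ℝ, E) ∞ M] [IsManifold 𝓘(ℝ, E') ∞ M']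
    {φ : OpenPartialHomeomorph M E} (hφ : φ ∈ IsManifold.maximalAtlas 𝓘(ℝ, E) ∞ M)
    {ψ : OpenPartialHomeomorph M' E'} (hψ : ψ ∈ IsManifold.maximalAtlas 𝓘(ℝ, E') ∞ M')
    {F : M → M'} (hF : ContMDiff 𝓘(ℝ, E) 𝓘(ℝ, E') ∞ F) :
    graphSliceChart φ ψ F hF.continuous ∈
      @IsManifold.maximalAtlas ℝ _ (E × E') _ _ (E × E') _ 𝓘(ℝ, E × E') ∞ (M × M') _
        (inferInstanceAs (ChartedSpace (ModelProd E E') (M × M'))) := by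
  have h1 := contMDiffOn_of_mem_maximalAtlas hφ
  have h2 := contMDiffOn_symm_of_mem_maximalAtlas hφ
  have h3 := contMDiffOn_of_mem_maximalAtlas hψ
  have h4 := contMDiffOn_symm_of_mem_maximalAtlas hψ
  -- The model space is charted both over itself and as a product; the two structures agree, so
  -- smoothness can be checked componentwise.
  have hs : chartedSpaceSelf (ModelProd E E') = prodChartedSpace E E E' E' :=
    chartedSpaceSelf_prod.symm
  rw [modelWithCornersSelf_prod]
  refine OpenPartialHomeomorph.mem_maximalAtlas_of_contMDiffOn
    (I := 𝓘(ℝ, E).prod 𝓘(ℝ, E')) (M := M × M') (graphSliceChart φ ψ F hF.continuous) ?_ ?_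
  · rw [hs]
    have h : ContMDiffOn (𝓘(ℝ, E).prod 𝓘(ℝ, E')) 𝓘(ℝ, E) ∞ (fun z : M × M' => φ z.1)
        (graphSliceChart φ ψ F hF.continuous).source :=
      h1.comp contMDiffOn_fst fun z hz => hz.1.1
    exact h.prodMk <| (h3.comp contMDiffOn_snd fun z hz => hz.2).sub
      (h3.comp (hF.comp_contMDiffOn contMDiffOn_fst) fun z hz => hz.1.2)
  · rw [hs]
    have h : ContMDiffOn (𝓘(ℝ, E).prod 𝓘(ℝ, E')) 𝓘(ℝ, E) ∞ (fun y : E × E' => φ.symm y.1)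
        (graphSliceChart φ ψ F hF.continuous).target :=
      h2.comp contMDiffOn_fst fun y hy => hy.1.1.1
    refine h.prodMk (h4.comp (ContMDiffOn.add contMDiffOn_snd
      (h3.comp (hF.comp_contMDiffOn h) ?_)) ?_)
    · exact fun y hy => hy.1.1.2
    · exact fun y hy => hy.2

/-- Subtracting `ψ (F p)` straightens the graph onto `E × 0`: injectivity of `ψ` on its source turns
a vanishing second coordinate into `q = F p`. -/
theorem isSubmanifold_graph [IsManifold 𝓘(ℝ, E) ∞ M] [IsManifold 𝓘(ℝ, E') ∞ M']
    {F : M → M'} (hF : ContMDiff 𝓘(ℝ, E) 𝓘(ℝ, E') ∞ F) :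
    @IsSubmanifold (E × E') _ _ (M × M') _
      (inferInstanceAs (ChartedSpace (ModelProd E E') (M × M')))
      (Module.finrank ℝ E) {z | F z.1 = z.2} := by
  rintro ⟨p, q⟩ hq
  obtain rfl : F p = q := hq
  refine ⟨_, graphSliceChart_mem_maximalAtlas (IsManifold.chart_mem_maximalAtlas p)
    (IsManifold.chart_mem_maximalAtlas (F p)) hF,
    ⟨⟨mem_chart_source E p, mem_chart_source E' (F p)⟩, mem_chart_source E' (F p)⟩,
    LinearMap.range (LinearMap.inl ℝ E E'), ?_, ?_⟩
  · exact LinearMap.finrank_range_of_inj LinearMap.inl_injective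
  · rintro ⟨a, b⟩ ⟨⟨ha, hFa⟩, hb⟩
    rw [LinearMap.range_inl, LinearMap.mem_ker]
    change _ ↔ chartAt E' (F p) b - chartAt E' (F p) (F a) = 0
    rw [sub_eq_zero, (chartAt E' (F p)).injOn.eq_iff hb hFa]
    exact eq_comm

end Graph

/-! ### Graphs in product charts -/

namespace OrbifoldChart

variable {E E' : Type*} [NormedAddCommGroup E] [NormedSpace ℝ E]
  [NormedAddCommGroup E'] [NormedSpace ℝ E']
  {X X' : Type*} [TopologicalSpace X] [TopologicalSpace X']
  {c : OrbifoldChart.{w} E X} {c' : OrbifoldChart.{w} E' X'}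

variable (c c') in
/-- The graph of a map between chart domains, in the domain of the product chart. -/
def graph (F : c.carrier → c'.carrier) : Set (c.prod c').carrier :=
  {z : c.carrier × c'.carrier | F z.1 = z.2}

theorem image_mk_eq_graph_inter (F : c.carrier → c'.carrier) (S : Set c.carrier) :
    (fun p => (p, F p) : c.carrier → c.carrier × c'.carrier) '' S =
      {z | z ∈ c.graph c' F ∧ z.1 ∈ S} := by
  ext ⟨p, q⟩
  constructor
  · rintro ⟨p, hp, h⟩
    cases h
    exact ⟨rfl, hp⟩
  · rintro ⟨h, hp⟩
    exact ⟨p, hp, Prod.ext rfl h⟩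

/-- `Δ` is the graph of `φ`. If `(γ, δ)` keeps `(p, F p)` on the graph, then `δ • F p = F (γ • p) =
φ γ • F p`, so `(γ, φ γ)` moves this point in the same way. -/
theorem isGroupSubmanifold_graph {F : c.carrier → c'.carrier} {φ : c.group →* c'.group}
    (hF : ContMDiff 𝓘(ℝ, E) 𝓘(ℝ, E') ∞ F) (hφ : ∀ γ p, F (γ • p) = φ γ • F p) :
    ∃ Δ : Subgroup (c.prod c').group,
      IsGroupSubmanifold (E × E') (Module.finrank ℝ E) Δ (c.graph c' F) := by
  refine ⟨(φ.graph : Subgroup (c.group × c'.group)), isSubmanifold_graph hF, ?_, ?_⟩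
  · rintro ⟨γ, δ⟩ hδ ⟨p, q⟩ hq
    obtain rfl : φ γ = δ := hδ
    obtain rfl : F p = q := hq
    exact hφ γ p
  · rintro ⟨γ, δ⟩ ⟨p, q⟩ hq h
    obtain rfl : F p = q := hq
    refine ⟨(γ, φ γ), rfl, Prod.ext rfl ?_⟩
    have h : F (γ • p) = δ • F p := h
    change φ γ • F p = δ • F p
    rw [← h, hφ]

theorem stabilizer_prod_eq_bot_iff (z : (c.prod c').carrier) :
    MulAction.stabilizer (c.prod c').group z = ⊥ ↔
      MulAction.stabilizer c.group z.1 = ⊥ ∧ MulAction.stabilizer c'.group z.2 = ⊥ := by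
  simp only [Subgroup.eq_bot_iff_forall]
  constructor
  · intro h
    exact ⟨fun γ hγ => congrArg Prod.fst (h (γ, 1) (Prod.ext hγ (one_smul _ _))),
      fun δ hδ => congrArg Prod.snd (h (1, δ) (Prod.ext (one_smul _ _) hδ))⟩
  · rintro ⟨h, h'⟩ γ hγ
    exact Prod.ext (h γ.1 (congrArg Prod.fst hγ)) (h' γ.2 (congrArg Prod.snd hγ))

theorem image_proj_graph {F : c.carrier → c'.carrier} {f : X → X'}
    (h : ∀ p, c'.proj (F p) = f (c.proj p)) :
    (c.prod c').proj '' c.graph c' F = (c.source ×ˢ Set.univ) ∩ {z : X × X' | f z.1 = z.2} := by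
  ext ⟨x, y⟩
  constructor
  · rintro ⟨⟨p, q⟩, hq, hxy⟩
    obtain rfl : F p = q := hq
    cases hxy
    exact ⟨⟨⟨p, rfl⟩, trivial⟩, (h p).symm⟩
  · rintro ⟨⟨⟨p, rfl⟩, -⟩, hy⟩
    obtain rfl : f (c.proj p) = y := hy
    exact ⟨(p, F p), rfl, Prod.ext rfl (h p)⟩

theorem isOpen_source (c : OrbifoldChart.{w} E X) : IsOpen c.source :=
  c.isOpenMap_proj.isOpen_range

/-- `V` is the graph of an equivariant lift of `f` with respect to charts of `O` and `O'`. -/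
inductive IsLiftGraph (O : Orbifold.{w} E X) (O' : Orbifold.{w} E' X') (f : X → X') :
    (C : OrbifoldChart.{w} (E × E') (X × X')) → Set C.carrier → Prop
  | intro (c : OrbifoldChart.{w} E X) (c' : OrbifoldChart.{w} E' X') (hc : c ∈ O.charts)
      (hc' : c' ∈ O'.charts) (F : c.carrier → c'.carrier) (φ : c.group →* c'.group)
      (hF : ContMDiff 𝓘(ℝ, E) 𝓘(ℝ, E') ∞ F) (hFf : ∀ p, c'.proj (F p) = f (c.proj p))
      (hφ : ∀ γ p, F (γ • p) = φ γ • F p) : IsLiftGraph O O' f (c.prod c') (c.graph c' F)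

/-- `V` is the diagonal in the square of a chart of `O`. -/
inductive IsChartDiagonal (O : Orbifold.{w} E X) :
    (C : OrbifoldChart.{w} (E × E) (X × X)) → Set C.carrier → Prop
  | intro (c : OrbifoldChart.{w} E X) (hc : c ∈ O.charts) :
      IsChartDiagonal O (c.prod c) (c.graph c id)

theorem IsChartDiagonal.isLiftGraph {O : Orbifold.{w} E X}
    {C : OrbifoldChart.{w} (E × E) (X × X)} {V : Set C.carrier} (h : IsChartDiagonal O C V) :
    IsLiftGraph O O id C V := by
  obtain ⟨c, hc⟩ := h
  exact .intro c c hc hc id (MonoidHom.id _) contMDiff_id (fun _ => rfl) fun _ _ => rfl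

namespace IsLiftGraph

variable {O : Orbifold.{w} E X} {O' : Orbifold.{w} E' X'} {f : X → X'}
  {C : OrbifoldChart.{w} (E × E') (X × X')} {V : Set C.carrier}

theorem isConnected (h : IsLiftGraph O O' f C V) : IsConnected V := by
  obtain ⟨c, c', -, -, F, φ, hF, -, -⟩ := h
  have := (isConnected_univ (α := c.carrier)).image (fun p => (p, F p))
    (continuous_id.prodMk hF.continuous).continuousOn
  rw [image_mk_eq_graph_inter] at this
  simp only [Set.mem_univ, and_true] at this
  exact this

theorem isClosed (h : IsLiftGraph O O' f C V) : IsClosed V := by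
  obtain ⟨c, c', -, -, F, φ, hF, -, -⟩ := h
  exact isClosed_eq (hF.continuous.comp continuous_fst) continuous_snd

theorem isGroupSubmanifold (h : IsLiftGraph O O' f C V) :
    ∃ Δ : Subgroup C.group, IsGroupSubmanifold (E × E') (Module.finrank ℝ E) Δ V := by
  obtain ⟨c, c', -, -, F, φ, hF, -, hφ⟩ := h
  exact isGroupSubmanifold_graph hF hφ

theorem isOpen_image (h : IsLiftGraph O O' f C V) :
    ∃ W : Set (X × X'), IsOpen W ∧ C.proj '' V = W ∩ {z | f z.1 = z.2} := by
  obtain ⟨c, c', -, -, F, φ, -, hFf, -⟩ := h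
  exact ⟨_, c.isOpen_source.prod isOpen_univ, image_proj_graph hFf⟩

theorem isConnected_dense_stabilizer_eq_bot [FiniteDimensional ℝ E]
    (hO : O.SingularStrataCodimAtLeastTwo)
    (hf : ∀ x, O.IsRegularPoint x → O'.IsRegularPoint (f x)) (h : IsLiftGraph O O' f C V) :
    IsConnected {p ∈ V | MulAction.stabilizer C.group p = ⊥} ∧
      V ⊆ closure {p ∈ V | MulAction.stabilizer C.group p = ⊥} := by
  obtain ⟨c, c', hc, hc', F, φ, hF, hFf, -⟩ := h
  have hcont : Continuous (fun p => (p, F p) : c.carrier → c.carrier × c'.carrier) :=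
    continuous_id.prodMk hF.continuous
  have hset : (fun p => (p, F p) : c.carrier → c.carrier × c'.carrier) '' c.regularSet =
      {z ∈ c.graph c' F | MulAction.stabilizer (c.prod c').group z = ⊥} := by
    rw [image_mk_eq_graph_inter]
    ext ⟨p, q⟩
    refine and_congr_right fun hq => ?_
    obtain rfl : F p = q := hq
    refine Iff.trans ?_ (stabilizer_prod_eq_bot_iff (c := c) (c' := c') (p, F p)).symm
    -- Trivial isotropy at `p` makes its image in `X` regular, hence also the image under `f`, which
    -- forces trivial isotropy at `F p`.
    exact ⟨fun hp => ⟨hp, hf _ (isRegularPoint_of_stabilizer_eq_bot hO hc hp) c' hc' _ (hFf p)⟩,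
      fun hp => hp.1⟩
  obtain ⟨hcon, hd⟩ := isConnected_dense_regularSet hO hc
  rw [← hset]
  refine ⟨hcon.image _ hcont.continuousOn, ?_⟩
  rintro ⟨p, q⟩ hq
  obtain rfl : F p = q := hq
  exact image_closure_subset_closure_image hcont ⟨p, hd p, rfl⟩

end IsLiftGraph

/-- If `(γ, δ)` fixes an open piece of the diagonal, then `γ` and `δ` each fix an open subset of the
chart domain. -/
theorem IsChartDiagonal.eq_one_of_fixes_open [FiniteDimensional ℝ E] {O : Orbifold.{w} E X}
    (hO : O.SingularStrataCodimAtLeastTwo) {C : OrbifoldChart.{w} (E × E) (X × X)}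
    {V : Set C.carrier} (h : IsChartDiagonal O C V) (γ : C.group) (W : Set C.carrier)
    (hW : IsOpen W) (hne : (W ∩ V).Nonempty) (hγ : ∀ p ∈ W ∩ V, γ • p = p) : γ = 1 := by
  obtain ⟨c, hc⟩ := h
  have hd := (isConnected_dense_regularSet hO hc).2
  have hcont : Continuous (fun p => (p, p) : c.carrier → c.carrier × c.carrier) :=
    continuous_id.prodMk continuous_id
  have hWo := hW.preimage hcont
  obtain ⟨⟨p, q⟩, hpW, hq⟩ := hne
  obtain rfl : p = q := hq
  exact Prod.ext
    (eq_one_of_smul_eq_on_open hd hWo ⟨p, hpW⟩ fun a ha =>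
      congrArg Prod.fst (hγ (a, a) ⟨ha, rfl⟩))
    (eq_one_of_smul_eq_on_open hd hWo ⟨p, hpW⟩ fun a ha =>
      congrArg Prod.snd (hγ (a, a) ⟨ha, rfl⟩))

/-- A chart `b` witnessing compatibility on `X`, with injections `l` and `m`, gives `b × b` with `l
× l` and `m × m`, which carry diagonal to diagonal. -/
theorem IsChartDiagonal.exists_common_chart {O : Orbifold.{w} E X}
    {C D : OrbifoldChart.{w} (E × E) (X × X)} {V : Set C.carrier} {W : Set D.carrier}
    (h : IsChartDiagonal O C V) (h' : IsChartDiagonal O D W) (x : X × X)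
    (hx : x ∈ C.proj '' V ∩ D.proj '' W) :
    ∃ (b : OrbifoldChart.{w} (E × E) (X × X)) (L : Subgroup b.group) (Z : Set b.carrier),
      IsGroupSubmanifold (E × E) (Module.finrank ℝ E) L Z ∧ x ∈ b.proj '' Z ∧
      (∃ U : Set (X × X), IsOpen U ∧ b.proj '' Z = U ∩ Set.diagonal X) ∧
      (∃ l : b.carrier → C.carrier, b.IsInjection C l ∧ Set.MapsTo l Z V) ∧
      (∃ m : b.carrier → D.carrier, b.IsInjection D m ∧ Set.MapsTo m Z W) := by
  obtain ⟨c, hc⟩ := h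
  obtain ⟨d, hd⟩ := h'
  have hid : ∀ c : OrbifoldChart.{w} E X, (c.prod c).proj '' c.graph c id =
      (c.source ×ˢ Set.univ) ∩ Set.diagonal X := fun c => image_proj_graph (f := id) fun _ => rfl
  rw [hid, hid] at hx
  obtain ⟨b, hxb, -, ⟨l, hl⟩, ⟨m, hm⟩⟩ := O.isOrbifoldAtlas.compatible ⟨c, hc⟩ ⟨d, hd⟩ x.1
    ⟨hx.1.1.1, hx.2.1.1⟩
  obtain ⟨L, hL⟩ := isGroupSubmanifold_graph (c := b) (c' := b) (F := id) (φ := MonoidHom.id _)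
    contMDiff_id fun _ _ => rfl
  refine ⟨b.prod b, L, b.graph b id, hL, ?_, ⟨_, b.isOpen_source.prod isOpen_univ, hid b⟩,
    ⟨_, hl.prod hl, ?_⟩, ⟨_, hm.prod hm, ?_⟩⟩
  · rw [hid]
    exact ⟨⟨hxb, trivial⟩, hx.1.2⟩
  · exact fun z hz => congrArg l hz
  · exact fun z hz => congrArg m hz

end OrbifoldChart

/-! ### Countable covers -/

section Cover

variable {E : Type*} [NormedAddCommGroup E] [NormedSpace ℝ E]
  {X : Type*} [TopologicalSpace X] [SecondCountableTopology X]

/-- The charts carrying pieces of `Y` need not cover `X`. Lindelöf is applied twice: to the pieces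
over `Y` (left summand, which is `J`) and to charts over all of `X` (right summand). -/
theorem exists_countable_atlas_with_cover {𝒜 : Set (OrbifoldChart.{w} E X)}
    (hcomp : ∀ c ∈ 𝒜, ∀ d ∈ 𝒜, c.Compatible d) (hcov : ∀ x, ∃ c ∈ 𝒜, x ∈ c.source) {Y : Set X}
    {P : (c : OrbifoldChart.{w} E X) → Set c.carrier → Prop}
    (hopen : ∀ c V, P c V → ∃ W : Set X, IsOpen W ∧ c.proj '' V = W ∩ Y)
    (hY : ∀ y ∈ Y, ∃ c ∈ 𝒜, ∃ V, P c V ∧ y ∈ c.proj '' V) :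
    ∃ (ι : Type) (_ : Countable ι) (c : ι → OrbifoldChart.{w} E X), IsOrbifoldAtlas c ∧
      (∀ i, c i ∈ 𝒜) ∧ ∃ (J : Set ι) (V : (j : J) → Set (c j).carrier),
        (∀ j : J, P (c j) (V j)) ∧ ⋃ j : J, (c j).proj '' V j = Y := by
  have hY' : ∀ y : Y, ∃ c ∈ 𝒜, ∃ V, ∃ W : Set X,
      P c V ∧ IsOpen W ∧ c.proj '' V = W ∩ Y ∧ y.1 ∈ W := by
    intro y
    obtain ⟨c, hc, V, hV, hy⟩ := hY y y.2
    obtain ⟨W, hW, hVW⟩ := hopen c V hV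
    exact ⟨c, hc, V, W, hV, hW, hVW, (hVW ▸ hy : y.1 ∈ W ∩ Y).1⟩
  choose c hc V W hV hW hVW hyW using hY'
  choose d hd hxd using hcov
  obtain ⟨S, hS, hSW⟩ := TopologicalSpace.isOpen_iUnion_countable W hW
  obtain ⟨T, hT, hTd⟩ := TopologicalSpace.isOpen_iUnion_countable (fun x => (d x).source)
    fun x => (d x).isOpen_source
  have := hS.to_subtype
  have := hT.to_subtype
  -- The countable index sets are moved to the lowest universe, where the index type is required to
  -- live.
  let eS : S ≃ Shrink.{0} S := equivShrink.{0} S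
  let eT : T ≃ Shrink.{0} T := equivShrink.{0} T
  let C : Shrink.{0} S ⊕ Shrink.{0} T → OrbifoldChart.{w} E X :=
    Sum.elim (fun s => c (eS.symm s)) fun t => d (eT.symm t).1
  have hC : ∀ i, C i ∈ 𝒜 := by
    rintro (s | t)
    exacts [hc _, hd _]
  -- The value `∅` on the right summand is never used, since `J` is the left one.
  let W' : Shrink.{0} S ⊕ Shrink.{0} T → Set X :=
    Sum.elim (fun s => W (eS.symm s)) fun _ => ∅
  have hJ : ∀ j : Set.range (Sum.inl : Shrink.{0} S → Shrink.{0} S ⊕ Shrink.{0} T),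
      ∃ V : Set (C j).carrier, P (C j) V ∧ (C j).proj '' V = W' j ∩ Y := by
    rintro ⟨_, s, rfl⟩
    exact ⟨_, hV _, hVW _⟩
  choose V' hV' hVW' using hJ
  refine ⟨_, ?_, C, ⟨?_, fun i j => hcomp _ (hC i) _ (hC j)⟩, hC, _, V', hV', ?_⟩
  · have : Countable (Shrink.{0} S) := eS.symm.injective.countable
    have : Countable (Shrink.{0} T) := eT.symm.injective.countable
    infer_instance
  · refine Set.eq_univ_of_forall fun x => ?_
    have hx : x ∈ ⋃ x, (d x).source := Set.mem_iUnion.2 ⟨x, hxd x⟩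
    rw [← hTd] at hx
    obtain ⟨t, ht, hxt⟩ := Set.mem_iUnion₂.1 hx
    refine Set.mem_iUnion.2 ⟨Sum.inr (eT ⟨t, ht⟩), ?_⟩
    simpa [C] using hxt
  · ext y
    constructor
    · intro hy
      obtain ⟨j, hj⟩ := Set.mem_iUnion.1 hy
      rw [hVW'] at hj
      exact hj.2
    · intro hy
      have hx : y ∈ ⋃ y, W y := Set.mem_iUnion.2 ⟨⟨y, hy⟩, hyW _⟩
      rw [← hSW] at hx
      obtain ⟨s, hs, hys⟩ := Set.mem_iUnion₂.1 hx
      refine Set.mem_iUnion.2 ⟨⟨Sum.inl (eS ⟨s, hs⟩), ⟨_, rfl⟩⟩, ?_⟩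
      rw [hVW']
      refine ⟨?_, hy⟩
      simpa [W'] using hys

end Cover

/-! ### Suborbifold covers of graphs and of the diagonal -/

namespace Orbifold

variable {E E' : Type*} [NormedAddCommGroup E] [NormedSpace ℝ E]
  [NormedAddCommGroup E'] [NormedSpace ℝ E']
  {X X' : Type*} [TopologicalSpace X] [TopologicalSpace X']

theorem exists_mem_source (O : Orbifold.{w} E X) (x : X) : ∃ c ∈ O.charts, x ∈ c.source := by
  have hx : x ∈ ⋃ c : O.charts, (c : OrbifoldChart.{w} E X).source := by
    rw [O.isOrbifoldAtlas.cover]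
    trivial
  obtain ⟨c, hc⟩ := Set.mem_iUnion.1 hx
  exact ⟨c, c.2, hc⟩

variable [SecondCountableTopology X] [SecondCountableTopology X']

/-- The predicate `P` restricts the admissible lifts: all of them for (a), only chart diagonals for
(b), where common charts are needed. -/
theorem exists_countable_atlas_with_graph_cover (O : Orbifold.{w} E X) (O' : Orbifold.{w} E' X')
    (f : X → X') {P : (C : OrbifoldChart.{w} (E × E') (X × X')) → Set C.carrier → Prop}
    (hP : ∀ C V, P C V → OrbifoldChart.IsLiftGraph O O' f C V)
    (hf : ∀ x, ∃ c ∈ O.charts, ∃ c' ∈ O'.charts, ∃ V, P (c.prod c') V ∧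
      (x, f x) ∈ (c.prod c').proj '' V) :
    ∃ (ι : Type) (_ : Countable ι) (c : ι → OrbifoldChart.{w} (E × E') (X × X')),
      IsOrbifoldAtlas c ∧ (∀ i, c i ∈ O.prodCharts O') ∧
      ∃ (J : Set ι) (V : (j : J) → Set (c j).carrier), (∀ j : J, P (c j) (V j)) ∧
        IsClosedSuborbifoldCover c (Module.finrank ℝ E) J V {z | f z.1 = z.2} := by
  -- Only product charts are used: their pairwise compatibility comes from the factors, so none is
  -- needed between arbitrary members of `prodCharts`.
  let 𝒜 : Set (OrbifoldChart.{w} (E × E') (X × X')) :=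
    {C | ∃ c ∈ O.charts, ∃ c' ∈ O'.charts, C = c.prod c'}
  have hcomp : ∀ C ∈ 𝒜, ∀ D ∈ 𝒜, C.Compatible D := by
    rintro _ ⟨c, hc, c', hc', rfl⟩ _ ⟨d, hd, d', hd', rfl⟩
    exact OrbifoldChart.prod_mem_prodCharts hc hc' d hd d' hd'
  have hsource : ∀ x, ∃ C ∈ 𝒜, x ∈ C.source := by
    rintro ⟨x, x'⟩
    obtain ⟨c, hc, hx⟩ := O.exists_mem_source x
    obtain ⟨c', hc', hx'⟩ := O'.exists_mem_source x'
    exact ⟨_, ⟨c, hc, c', hc', rfl⟩, by rw [OrbifoldChart.source_prod]; exact ⟨hx, hx'⟩⟩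
  have hY : ∀ z ∈ {z : X × X' | f z.1 = z.2}, ∃ C ∈ 𝒜, ∃ V, P C V ∧ z ∈ C.proj '' V := by
    rintro ⟨x, y⟩ hy
    obtain rfl : f x = y := hy
    obtain ⟨c, hc, c', hc', V, hV, hx⟩ := hf x
    exact ⟨_, ⟨c, hc, c', hc', rfl⟩, V, hV, hx⟩
  obtain ⟨ι, hι, c, hc, hmem, J, V, hV, hcov⟩ := exists_countable_atlas_with_cover hcomp hsource
    (fun C V h => (hP C V h).isOpen_image) hY
  refine ⟨ι, hι, c, hc, fun i => ?_, J, V, hV, fun j => (hP _ _ (hV j)).isConnected,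
    fun j => (hP _ _ (hV j)).isGroupSubmanifold, fun j => (hP _ _ (hV j)).isOpen_image, hcov,
    fun j => (hP _ _ (hV j)).isClosed⟩
  obtain ⟨d, hd, d', hd', h⟩ := hmem i
  rw [h]
  exact OrbifoldChart.prod_mem_prodCharts hd hd'

theorem isRegularSuborbifold_graph [FiniteDimensional ℝ E] {O : Orbifold.{w} E X}
    (hO : O.SingularStrataCodimAtLeastTwo) {O' : Orbifold.{w} E' X'} {f : X → X'}
    (hf : O.IsSmoothMap O' f) (hreg : ∀ x, O.IsRegularPoint x → O'.IsRegularPoint (f x)) :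
    IsRegularSuborbifold (O.prodCharts O') {z : X × X' | f z.1 = z.2} := by
  obtain ⟨ι, hι, c, hc, hmem, J, V, hV, hcov⟩ := O.exists_countable_atlas_with_graph_cover O' f
    (P := OrbifoldChart.IsLiftGraph O O' f) (fun _ _ h => h) (by
      intro x
      obtain ⟨c, hc, c', hc', ⟨p, rfl⟩, -, F, φ, hF, hFf, hφ⟩ := hf.2 x
      exact ⟨c, hc, c', hc', _, .intro c c' hc hc' F φ hF hFf hφ, (p, F p), rfl,
        Prod.ext rfl (hFf p)⟩)
  exact ⟨ι, hι, c, hc, hmem, _, J, V, hcov,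
    fun j => ((hV j).isConnected_dense_stabilizer_eq_bot hO hreg).2,
    fun j => ((hV j).isConnected_dense_stabilizer_eq_bot hO hreg).1⟩

theorem isVeryStrongSuborbifold_diagonal [FiniteDimensional ℝ E] {O : Orbifold.{w} E X}
    (hO : O.SingularStrataCodimAtLeastTwo) :
    IsVeryStrongSuborbifold (O.prodCharts O) (Set.diagonal X) := by
  obtain ⟨ι, hι, c, hc, hmem, J, V, hV, hcov⟩ := O.exists_countable_atlas_with_graph_cover O id
    (P := OrbifoldChart.IsChartDiagonal O) (fun _ _ h => h.isLiftGraph) (by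
      intro x
      obtain ⟨c, hc, ⟨p, rfl⟩⟩ := O.exists_mem_source x
      exact ⟨c, hc, c, hc, _, .intro c hc, (p, p), rfl, rfl⟩)
  exact ⟨ι, hι, c, hc, hmem, _, J, V, hcov,
    fun j => (hV j).eq_one_of_fixes_open hO,
    fun i j => (hV i).exists_common_chart (hV j)⟩

end Orbifold

theorem mainTheorem4 {E : Type*} [NormedAddCommGroup E] [NormedSpace ℝ E] [FiniteDimensional ℝ E]
    {X : Type*} [TopologicalSpace X] [T2Space X] [SecondCountableTopology X]
    (O : Orbifold.{w} E X) (hO : O.SingularStrataCodimAtLeastTwo) :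
    (∀ {E' : Type*} [NormedAddCommGroup E'] [NormedSpace ℝ E'] [FiniteDimensional ℝ E']
        {X' : Type*} [TopologicalSpace X'] [T2Space X'] [SecondCountableTopology X']
        (O' : Orbifold.{w} E' X') (f : X → X'),
        O.IsSmoothMap O' f →
        (∀ x, O.IsRegularPoint x → O'.IsRegularPoint (f x)) →
        IsRegularSuborbifold (O.prodCharts O') {z : X × X' | f z.1 = z.2}) ∧
      IsVeryStrongSuborbifold (O.prodCharts O) (Set.diagonal X) :=
  ⟨fun _ _ hf hreg => Orbifold.isRegularSuborbifold_graph hO hf hreg,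
    Orbifold.isVeryStrongSuborbifold_diagonal hO⟩

end
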